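/- Let $q>1$ and $\tfrac23 q+1<p<q+\tfrac23$. For $n\in\mathbb N$ and a $C^1$ curve $\gamma:\mathbb R/\mathbb Z\to\mathbb R^n$ define the generalized integral Menger curvature $$\mathrm{E}^{(p,q)}(\gamma):=\iiint_{(\mathbb R/\mathbb Z)^3}\frac{|\gamma'(u_1)|\,|\gamma'(u_2)|\,|\gamma'(u_3)|}{R^{(p,q)}(\gamma(u_1),\gamma(u_2),\gamma(u_3))}\,du_1\,du_2\,du_3\in[0,\infty],$$ $$R^{(p,q)}(x,y,z):=\frac{\big(|y-z|\,|y-x|\,|z-x|\big)^p}{|(y-x)\wedge(z-x)|^q},$$ where $|a\wedge b|=\sqrt{|a|^2|b|^2-\langle a,b\rangle^2}$. Then for every $M<\infty$ there is a constant $C=C(M,p,q)>0$, depending only on $M,p,q$ (in particular not on $n$), such that for every $n$, every injective curve $\gamma\in C^1(\mathbb R/\mathbb Z,\mathbb R^n)$ parametrized by arc-length (i.e. $|\gamma'|\equiv 1$) with $\mathrm{E}^{(p,q)}(\gamma)\le M$ satisfies $$|u-v|\le C\,|\gamma(u)-\gamma(v)|\qquad\text{for all }u,v\in\mathbb R/\mathbb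 Z,$$ where $|u-v|=\min_{k\in\mathbb Z}|u-v-k|$ denotes the distance on $\mathbb R/\mathbb Z$. -/

import Mathlib

open MeasureTheory
open scoped ENNReal

noncomputable section

/-- `|a ∧ b|`, the Euclidean norm of the bivector `a ∧ b`, i.e. the area of the parallelogram
spanned by `a` and `b` (square root of the Gram determinant). -/
def wedgeNorm {n : ℕ} (a b : EuclideanSpace ℝ (Fin n)) : ℝ :=
  Real.sqrt (‖a‖ ^ 2 * ‖b‖ ^ 2 - (inner ℝ a b) ^ 2)

/-- The generalized circumradius
`R^{(p,q)}(x,y,z) = (|y-z| |y-x| |z-x|)^p / |(y-x) ∧ (z-x)|^q`, with values in `[0,∞]`.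
For three distinct collinear points it equals `∞` (when `q > 0`). -/
def genCircumradius (p q : ℝ) {n : ℕ} (x y z : EuclideanSpace ℝ (Fin n)) : ℝ≥0∞ :=
  ENNReal.ofReal ((‖y - z‖ * ‖y - x‖ * ‖z - x‖) ^ p) /
    ENNReal.ofReal (wedgeNorm (y - x) (z - x) ^ q)

/-- The derivative `γ'(u)` of a closed curve `γ : ℝ/ℤ → ℝⁿ`. -/
def curveDeriv {n : ℕ} (γ : UnitAddCircle → EuclideanSpace ℝ (Fin n)) (u : UnitAddCircle) :
    EuclideanSpace ℝ (Fin n) :=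
  deriv (fun t : ℝ => γ (u + (t : UnitAddCircle))) 0

/-- The generalized integral Menger curvature: the triple integral over `(ℝ/ℤ)³` of
`|γ'(u₁)| |γ'(u₂)| |γ'(u₃)| / R^{(p,q)}(γ(u₁), γ(u₂), γ(u₃))`, with values in `[0,∞]`. -/
def mengerEnergy (p q : ℝ) {n : ℕ} (γ : UnitAddCircle → EuclideanSpace ℝ (Fin n)) : ℝ≥0∞ :=
  ∫⁻ u₁ : UnitAddCircle, ∫⁻ u₂ : UnitAddCircle, ∫⁻ u₃ : UnitAddCircle,
    ENNReal.ofReal (‖curveDeriv γ u₁‖ * ‖curveDeriv γ u₂‖ * ‖curveDeriv γ u₃‖) /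
      genCircumradius p q (γ u₁) (γ u₂) (γ u₃)

/-- Injective closed `C¹` curves `γ : ℝ/ℤ → ℝⁿ` parametrized by arc-length. -/
structure IsInjectiveArclengthC1 {n : ℕ} (γ : UnitAddCircle → EuclideanSpace ℝ (Fin n)) :
    Prop where
  contDiff : ContDiff ℝ 1 (fun t : ℝ => γ (t : UnitAddCircle))
  injective : Function.Injective γ
  arclength : ∀ u, ‖curveDeriv γ u‖ = 1

end

/-! A triangle of diameter at most `d` and area at least `κ d²` keeps its shape when its vertices
slide by about `κ d` along the curve, so it costs energy of order `κ^(q+3) d^(2q+3-3p)`. Bounded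
energy thus forces `κ ≤ K d^α`, where `α > 0` is precisely `p > 2q/3 + 1`
(`exists_wedgeNorm_le_of_mengerEnergy_le`).

Locally, `C¹` regularity bounds chords from below only up to a scale `ρ` depending on `γ`. Flatness
carries the bound up by doubling: consecutive half-chords are almost parallel, continuity keeps them
from turning antiparallel, and the losses of order `h^α` sum geometrically, so `ρ` drops out
(`half_mul_le_norm_sub_of_flat`).

Globally, take the closest pair `x, y` at arc distance at least `δ`. Were its gap `ε` small, the
directions from `γ x` to `γ y` and `γ (x ± ε)` would be pairwise almost antiparallel, which is
impossible for three vectors (`div_four_le_norm_sub_of_flat`). -/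

section Wedge

/-! ### Estimates for the wedge norm -/

variable {n : ℕ} (a b c : EuclideanSpace ℝ (Fin n))

lemma wedgeNorm_nonneg : 0 ≤ wedgeNorm a b := Real.sqrt_nonneg _

lemma wedgeNorm_sq : wedgeNorm a b ^ 2 = ‖a‖ ^ 2 * ‖b‖ ^ 2 - (inner ℝ a b) ^ 2 := by
  refine Real.sq_sqrt (sub_nonneg.2 ?_)
  rw [← mul_pow]
  exact sq_le_sq' (neg_le_of_abs_le (abs_real_inner_le_norm a b)) (real_inner_le_norm a b)

lemma wedgeNorm_comm : wedgeNorm a b = wedgeNorm b a := by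
  unfold wedgeNorm
  rw [real_inner_comm, mul_comm]

lemma wedgeNorm_neg_left : wedgeNorm (-a) b = wedgeNorm a b := by
  simp [wedgeNorm]

lemma wedgeNorm_le_mul : wedgeNorm a b ≤ ‖a‖ * ‖b‖ := by
  refine abs_le_of_sq_le_sq' ?_ (by positivity) |>.2
  rw [wedgeNorm_sq, mul_pow]
  linarith [sq_nonneg (inner ℝ a b)]

lemma mul_sub_wedgeNorm_le_abs_inner : ‖a‖ * ‖b‖ - wedgeNorm a b ≤ |inner ℝ a b| := by
  have h1 := wedgeNorm_sq a b
  have h2 := wedgeNorm_le_mul a b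
  have h3 := wedgeNorm_nonneg a b
  refine abs_le_of_sq_le_sq' ?_ (abs_nonneg _) |>.2
  rw [sq_abs]
  nlinarith

/-- The vector on the right is `‖a‖` times the component of `b` orthogonal to `a`. It is linear in
`b`, whence the triangle inequality below. -/
lemma wedgeNorm_eq_norm :
    wedgeNorm a b = ‖‖a‖ • b - (inner ℝ a b / ‖a‖) • a‖ := by
  rw [← sq_eq_sq₀ (wedgeNorm_nonneg a b) (norm_nonneg _), wedgeNorm_sq, norm_sub_sq_real,
    norm_smul, norm_smul, inner_smul_left, inner_smul_right, real_inner_comm]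
  rcases eq_or_ne a 0 with rfl | ha
  · simp
  have : ‖a‖ ≠ 0 := norm_ne_zero_iff.2 ha
  simp only [conj_trivial, Real.norm_eq_abs, mul_pow, sq_abs]
  field_simp
  ring

lemma wedgeNorm_add_right_le : wedgeNorm a (b + c) ≤ wedgeNorm a b + wedgeNorm a c := by
  simp only [wedgeNorm_eq_norm]
  refine le_of_eq_of_le ?_ (norm_add_le _ _)
  rw [inner_add_right, add_div, add_smul, smul_add]
  congr 1
  abel

lemma wedgeNorm_le_add_of_sub (a' b' : EuclideanSpace ℝ (Fin n)) :
    wedgeNorm a b ≤ wedgeNorm a' b' + ‖a - a'‖ * ‖b'‖ + ‖a‖ * ‖b - b'‖ := by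
  have h1 := wedgeNorm_add_right_le a b' (b - b')
  have h2 := wedgeNorm_add_right_le b' a' (a - a')
  rw [add_sub_cancel] at h1 h2
  have h3 := wedgeNorm_le_mul a (b - b')
  have h4 := wedgeNorm_le_mul b' (a - a')
  rw [wedgeNorm_comm b' a, wedgeNorm_comm b' a'] at h2
  linarith [mul_comm ‖b'‖ ‖a - a'‖]

end Wedge

/-! ### Lipschitz bounds and the energy cost of fat triangles -/

lemma mul_measure_le_lintegral {α : Type*} [MeasurableSpace α] {μ : Measure α} {s : Set α}
    (hs : MeasurableSet s) {f : α → ℝ≥0∞} {c : ℝ≥0∞} (h : ∀ x ∈ s, c ≤ f x) :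
    c * μ s ≤ ∫⁻ x, f x ∂μ := by
  rw [← setLIntegral_const]
  exact (setLIntegral_mono' hs h).trans (setLIntegral_le_lintegral s f)

namespace IsInjectiveArclengthC1

variable {n : ℕ} {γ : UnitAddCircle → EuclideanSpace ℝ (Fin n)}

lemma norm_deriv (hγ : IsInjectiveArclengthC1 γ) (t : ℝ) :
    ‖deriv (fun t : ℝ => γ (t : UnitAddCircle)) t‖ = 1 := by
  have h := hγ.arclength (t : UnitAddCircle)
  unfold curveDeriv at h
  have h2 := deriv_comp_const_add (f := fun t : ℝ => γ (t : UnitAddCircle)) t 0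
  simp only [AddCircle.coe_add, add_zero] at h2
  rwa [h2] at h

lemma norm_sub_le_abs (hγ : IsInjectiveArclengthC1 γ) (s t : ℝ) :
    ‖γ (s : UnitAddCircle) - γ (t : UnitAddCircle)‖ ≤ |s - t| := by
  have h : LipschitzWith 1 (fun t : ℝ => γ (t : UnitAddCircle)) :=
    lipschitzWith_of_nnnorm_deriv_le (hγ.contDiff.differentiable one_ne_zero) fun t => by
      rw [← NNReal.coe_le_coe, coe_nnnorm, hγ.norm_deriv t, NNReal.coe_one]
  simpa using h.norm_sub_le s t

end IsInjectiveArclengthC1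

lemma UnitAddCircle.exists_coe_eq_norm_eq (w : UnitAddCircle) :
    ∃ s : ℝ, (s : UnitAddCircle) = w ∧ |s| = ‖w‖ := by
  obtain ⟨s, rfl⟩ := QuotientAddGroup.mk_surjective w
  refine ⟨s - round s, ?_, (UnitAddCircle.norm_eq (x := s)).symm⟩
  have : ((round s : ℝ) : UnitAddCircle) = 0 := by
    rw [AddCircle.coe_eq_zero_iff]
    exact ⟨round s, by simp⟩
  rw [AddCircle.coe_sub, this, sub_zero]

namespace IsInjectiveArclengthC1

variable {n : ℕ} {γ : UnitAddCircle → EuclideanSpace ℝ (Fin n)}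

lemma norm_sub_le (hγ : IsInjectiveArclengthC1 γ) (u v : UnitAddCircle) :
    ‖γ u - γ v‖ ≤ ‖u - v‖ := by
  obtain ⟨s, hs, hs'⟩ := UnitAddCircle.exists_coe_eq_norm_eq (u - v)
  obtain ⟨t, rfl⟩ := QuotientAddGroup.mk_surjective v
  have : u = ((s + t : ℝ) : UnitAddCircle) := by
    rw [AddCircle.coe_add, hs]; exact (sub_add_cancel _ _).symm
  rw [← hs', this]
  exact (hγ.norm_sub_le_abs (s + t) t).trans_eq (by simp)

lemma continuous (hγ : IsInjectiveArclengthC1 γ) : Continuous γ :=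
  (LipschitzWith.of_dist_le_mul (K := 1) fun u v => by
    simpa [dist_eq_norm] using hγ.norm_sub_le u v).continuous

end IsInjectiveArclengthC1

/-- A triangle of diameter at most `d` and area at least `κ d²` inscribed in the curve costs energy:
all triangles obtained by moving its vertices by `κ d / 20` along the curve have comparable shape. -/
lemma le_mengerEnergy_of_fat_triangle {p q : ℝ} (hp : 0 < p) (hq : 0 < q) {n : ℕ}
    {γ : UnitAddCircle → EuclideanSpace ℝ (Fin n)} (hγ : IsInjectiveArclengthC1 γ)
    {κ d : ℝ} (hκ : 0 < κ) (hκ1 : κ ≤ 1) (hd : 0 < d) (hd1 : d ≤ 1) {u v w : UnitAddCircle}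
    (huv : ‖γ v - γ u‖ ≤ d) (huw : ‖γ w - γ u‖ ≤ d) (hvw : ‖γ v - γ w‖ ≤ d)
    (hW : κ * d ^ 2 ≤ wedgeNorm (γ v - γ u) (γ w - γ u)) :
    ENNReal.ofReal ((κ * d ^ 2 / 2) ^ q / (8 * d ^ 3) ^ p * (κ * d / 10) ^ 3)
      ≤ mengerEnergy p q γ := by
  -- Moving vertices by `r` changes each side by at most `2r`, hence the wedge by at most `2r(d +
  -- 2r) + 2rd`, less than `10rd = κ d² / 2`.
  set r := κ * d / 20 with hr
  have hr0 : 0 < r := by positivity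
  have hrd : 20 * r ≤ d := by rw [hr]; nlinarith
  set c := ENNReal.ofReal ((κ * d ^ 2 / 2) ^ q / (8 * d ^ 3) ^ p)
  set m := ENNReal.ofReal (κ * d / 10)
  have hvol : ∀ x : UnitAddCircle, volume (Metric.closedBall x r) = m := fun x => by
    rw [AddCircle.volume_closedBall, min_eq_right (by linarith)]
    congr 1
    rw [hr]; ring
  have hmove : ∀ x y : UnitAddCircle, y ∈ Metric.closedBall x r → ‖γ y - γ x‖ ≤ r :=
    fun x y hy => (hγ.norm_sub_le y x).trans (by rwa [← dist_eq_norm, ← Metric.mem_closedBall])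
  have key : ∀ u' ∈ Metric.closedBall u r, ∀ v' ∈ Metric.closedBall v r,
      ∀ w' ∈ Metric.closedBall w r, c ≤
        ENNReal.ofReal (‖curveDeriv γ u'‖ * ‖curveDeriv γ v'‖ * ‖curveDeriv γ w'‖) /
          genCircumradius p q (γ u') (γ v') (γ w') := by
    intro u' hu' v' hv' w' hw'
    have hu := hmove _ _ hu'
    have hv := hmove _ _ hv'
    have hw := hmove _ _ hw'
    have side : ∀ x y x' y' : EuclideanSpace ℝ (Fin n), ‖x' - x‖ ≤ r → ‖y' - y‖ ≤ r →
        ‖(x - y) - (x' - y')‖ ≤ 2 * r := fun x y x' y' hx hy => by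
      have : (x - y) - (x' - y') = (y' - y) - (x' - x) := by abel
      rw [this]
      exact (norm_sub_le _ _).trans (by linarith)
    have hvu2 := side _ _ _ _ hv hu
    have hwu2 := side _ _ _ _ hw hu
    have hvw2 := side _ _ _ _ hv hw
    have big : ∀ a b : EuclideanSpace ℝ (Fin n), ‖a‖ ≤ d → ‖a - b‖ ≤ 2 * r → ‖b‖ ≤ d + 2 * r :=
      fun a b ha hab => by
        have := norm_sub_norm_le b a
        rw [norm_sub_rev] at this
        linarith
    have hvu3 := big _ _ huv hvu2
    have hwu3 := big _ _ huw hwu2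
    have hvw3 := big _ _ hvw hvw2
    have hW' : κ * d ^ 2 / 2 ≤ wedgeNorm (γ v' - γ u') (γ w' - γ u') := by
      have h := wedgeNorm_le_add_of_sub (γ v - γ u) (γ w - γ u) (γ v' - γ u') (γ w' - γ u')
      have h1 : ‖(γ v - γ u) - (γ v' - γ u')‖ * ‖γ w' - γ u'‖ ≤ 2 * r * (d + 2 * r) :=
        mul_le_mul hvu2 hwu3 (norm_nonneg _) (by positivity)
      have h2 : ‖γ v - γ u‖ * ‖(γ w - γ u) - (γ w' - γ u')‖ ≤ d * (2 * r) :=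
        mul_le_mul huv hwu2 (norm_nonneg _) hd.le
      have h3 : κ * d ^ 2 = 20 * r * d := by rw [hr]; ring
      nlinarith
    have hS : ‖γ v' - γ w'‖ * ‖γ v' - γ u'‖ * ‖γ w' - γ u'‖ ≤ 8 * d ^ 3 := by
      have : 8 * d ^ 3 = (2 * d) * (2 * d) * (2 * d) := by ring
      rw [this]
      gcongr <;> linarith
    have hR : genCircumradius p q (γ u') (γ v') (γ w') ≤
        ENNReal.ofReal ((8 * d ^ 3) ^ p / (κ * d ^ 2 / 2) ^ q) := by
      rw [ENNReal.ofReal_div_of_pos (by positivity)]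
      unfold genCircumradius
      gcongr
    rw [hγ.arclength, hγ.arclength, hγ.arclength]
    simp only [mul_one, ENNReal.ofReal_one, one_div]
    refine le_trans (le_of_eq ?_) (ENNReal.inv_le_inv.2 hR)
    rw [← ENNReal.ofReal_inv_of_pos (by positivity), inv_div]
  have e : ENNReal.ofReal ((κ * d ^ 2 / 2) ^ q / (8 * d ^ 3) ^ p * (κ * d / 10) ^ 3)
      = c * m * m * m := by
    rw [ENNReal.ofReal_mul (by positivity), ENNReal.ofReal_pow (by positivity)]
    ring
  rw [e]
  unfold mengerEnergy
  have low : ∀ (x : UnitAddCircle) {c' : ℝ≥0∞} {F : UnitAddCircle → ℝ≥0∞},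
      (∀ y ∈ Metric.closedBall x r, c' ≤ F y) → c' * m ≤ ∫⁻ y, F y := fun x _ _ h => by
    rw [← hvol x]
    exact mul_measure_le_lintegral Metric.isClosed_closedBall.measurableSet h
  exact low u fun u' hu' => low v fun v' hv' => low w fun w' hw' => key u' hu' v' hv' w' hw'

/-- Bounded energy forces every inscribed triangle of diameter at most `d ≤ 1` to have area at most
`K d ^ (2 + α)`, with a constant independent of the curve. -/
lemma exists_wedgeNorm_le_of_mengerEnergy_le {p q : ℝ} (hp : 0 < p) (hq : 0 < q)
    {M : ℝ≥0∞} (hM : M < ∞) :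
    ∃ K : ℝ, 0 < K ∧ ∀ (n : ℕ) (γ : UnitAddCircle → EuclideanSpace ℝ (Fin n)),
      IsInjectiveArclengthC1 γ → mengerEnergy p q γ ≤ M →
        ∀ (u v w : UnitAddCircle) (d : ℝ), 0 < d → d ≤ 1 →
          ‖γ v - γ u‖ ≤ d → ‖γ w - γ u‖ ≤ d → ‖γ v - γ w‖ ≤ d →
            wedgeNorm (γ v - γ u) (γ w - γ u) ≤
              K * d ^ ((3 * p - 2 * q - 3) / (q + 3)) * d ^ 2 := by
  set α := (3 * p - 2 * q - 3) / (q + 3) with hα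
  have hα' : α * (q + 3) = 3 * p - 2 * q - 3 := div_mul_cancel₀ _ (by linarith)
  set c : ℝ := (1 / 2) ^ q / 8 ^ p / 10 ^ 3 with hc
  have hc0 : 0 < c := by positivity
  -- Chosen so that for `κ = K d^α` all powers of `d` cancel and the energy bound is exactly `M +
  -- 1`.
  set K : ℝ := ((M.toReal + 1) / c) ^ (1 / (q + 3)) with hK
  have hMr : 0 < M.toReal + 1 := by positivity
  have hK0 : 0 < K := by positivity
  have hKc : c * K ^ (q + 3) = M.toReal + 1 := by
    rw [hK, ← Real.rpow_mul (by positivity), one_div_mul_cancel (by linarith), Real.rpow_one]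
    field_simp
  refine ⟨K, hK0, fun n γ hγ hE u v w d hd hd1 h1 h2 h3 => ?_⟩
  by_contra! hlt
  have hκ1 : K * d ^ α ≤ 1 := by
    have : wedgeNorm (γ v - γ u) (γ w - γ u) ≤ d * d :=
      (wedgeNorm_le_mul _ _).trans (mul_le_mul h1 h2 (norm_nonneg _) hd.le)
    have h4 : 0 < d ^ 2 := by positivity
    nlinarith
  have hE' := (le_mengerEnergy_of_fat_triangle hp hq hγ (by positivity) hκ1 hd hd1 h1 h2 h3
    hlt.le).trans hE
  have e : (K * d ^ α * d ^ 2 / 2) ^ q / (8 * d ^ 3) ^ p * (K * d ^ α * d / 10) ^ 3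
      = M.toReal + 1 := by
    have e1 : (K * d ^ α * d ^ 2 / 2) ^ q = K ^ q * d ^ (α * q) * d ^ (2 * q) * (1 / 2) ^ q := by
      rw [div_eq_mul_one_div, Real.mul_rpow (by positivity) (by positivity),
        Real.mul_rpow (by positivity) (by positivity), Real.mul_rpow (by positivity) (by positivity),
        ← Real.rpow_mul hd.le, ← Real.rpow_natCast d 2, ← Real.rpow_mul hd.le]
      norm_num
    have e2 : (8 * d ^ 3) ^ p = 8 ^ p * d ^ (3 * p) := by
      rw [Real.mul_rpow (by positivity) (by positivity), ← Real.rpow_natCast d 3,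
        ← Real.rpow_mul hd.le]
      norm_num
    have e3 : (K * d ^ α * d / 10) ^ 3 = K ^ (3 : ℝ) * d ^ (α * 3) * d ^ (3 : ℝ) / 10 ^ 3 := by
      rw [div_pow, mul_pow, mul_pow, Real.rpow_mul hd.le]
      norm_cast
    have e4 : d ^ (α * q) * d ^ (2 * q) * d ^ (α * 3) * d ^ (3 : ℝ) = d ^ (3 * p) := by
      rw [← Real.rpow_add hd, ← Real.rpow_add hd, ← Real.rpow_add hd]
      congr 1
      linarith
    rw [e1, e2, e3, ← hKc, Real.rpow_add hK0, ← e4, hc]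
    field_simp
  rw [e, ENNReal.ofReal_le_iff_le_toReal hM.ne] at hE'
  linarith

/-! ### Chord-arc bound up to a uniform scale -/

section Local

variable {n : ℕ}

/-- With `S = ‖a‖ + ‖b‖` and `W` the wedge norm, `‖a + b‖² ≥ S² - 2W`, and this dominates `(S -
2W/S)²` because `2W ≤ S²`. -/
lemma norm_add_norm_sub_le_norm_add {a b : EuclideanSpace ℝ (Fin n)} (hab : 0 ≤ inner ℝ a b)
    {s : ℝ} (hs : 0 < s) (hsab : s ≤ ‖a‖ + ‖b‖) :
    ‖a‖ + ‖b‖ - 2 * wedgeNorm a b / s ≤ ‖a + b‖ := by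
  have hW0 := wedgeNorm_nonneg a b
  have hW := wedgeNorm_le_mul a b
  have hi := mul_sub_wedgeNorm_le_abs_inner a b
  rw [abs_of_nonneg hab] at hi
  set S := ‖a‖ + ‖b‖ with hS
  set W := wedgeNorm a b
  have hS0 : 0 < S := hs.trans_le hsab
  have h1 : 2 * W / S ≤ 2 * W / s := by gcongr
  refine le_trans (sub_le_sub_left h1 S) ?_
  refine abs_le_of_sq_le_sq' ?_ (norm_nonneg _) |>.2
  rw [norm_add_sq_real]
  have h2 : (S - 2 * W / S) ^ 2 = S ^ 2 - 4 * W + 2 * W * (2 * W / S ^ 2) := by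
    field_simp
    ring
  have h3 : 2 * W / S ^ 2 ≤ 1 := by
    rw [div_le_one (by positivity)]
    nlinarith [sq_nonneg (‖a‖ - ‖b‖)]
  nlinarith

/-- Flatness of all small inscribed triangles turns a lower bound on the chords at some
uncontrolled scale `ρ` into a lower bound on the chords at the controlled scale `δ`. -/
lemma half_mul_le_norm_sub_of_flat {f : ℝ → EuclideanSpace ℝ (Fin n)}
    (hf : ∀ s t, ‖f s - f t‖ ≤ |s - t|) {ρ : ℝ} (hρ : 0 < ρ)
    (hfρ : ∀ t h, 0 ≤ h → h ≤ ρ → 3 / 4 * h ≤ ‖f (t + h) - f t‖)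
    {K α δ : ℝ} (hα : 0 < α) (hK : 0 ≤ K) (hδ : 0 < δ)
    (hKδ : K * δ ^ α ≤ (1 - (1 / 2) ^ α) / 16)
    (flat : ∀ s t w d, 0 < d → d ≤ δ → ‖f t - f s‖ ≤ d → ‖f w - f s‖ ≤ d → ‖f t - f w‖ ≤ d →
      wedgeNorm (f t - f s) (f w - f s) ≤ K * d ^ α * d ^ 2)
    (t h : ℝ) (h0 : 0 ≤ h) (hhδ : h ≤ δ) : 1 / 2 * h ≤ ‖f (t + h) - f t‖ := by
  have hcont : Continuous f := (LipschitzWith.of_dist_le_mul (K := 1) fun u v => by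
    simpa [dist_eq_norm, Real.norm_eq_abs] using hf u v).continuous
  have hpow : 0 < ((1 : ℝ) / 2) ^ α := by positivity
  have le_one : ∀ h, 0 ≤ h → h ≤ δ → (h / δ) ^ α ≤ 1 := fun h h0 hh =>
    Real.rpow_le_one (by positivity) ((div_le_one hδ).2 hh) hα.le
  -- The correction `(h/δ)^α / 4` shrinks by `(1/2)^α` on halving; the room gained is exactly what
  -- the wedge loss `4 K h^α h` may use.
  have main : ∀ k : ℕ, ∀ h, 0 ≤ h → h ≤ 2 ^ k * ρ → h ≤ δ → ∀ t,
      h * (3 / 4 - (h / δ) ^ α / 4) ≤ ‖f (t + h) - f t‖ := by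
    intro k
    induction k with
    | zero =>
      intro h h0 hh _ t
      have := hfρ t h h0 (by simpa using hh)
      have h2 : 0 ≤ (h / δ) ^ α := by positivity
      nlinarith
    | succ k ih =>
      intro h h0 hh hhδ t
      rcases h0.eq_or_lt with rfl | hpos
      · simp
      set a : ℝ → EuclideanSpace ℝ (Fin n) := fun x => f (t + x / 2) - f t with ha
      set b : ℝ → EuclideanSpace ℝ (Fin n) := fun x => f (t + x) - f (t + x / 2) with hb
      have hab : ∀ x, a x + b x = f (t + x) - f t := fun x => by simp [ha, hb]
      have upa : ∀ x, 0 ≤ x → ‖a x‖ ≤ x / 2 := fun x hx =>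
        (hf _ _).trans_eq (by rw [add_sub_cancel_left, abs_of_nonneg (by linarith)])
      have upb : ∀ x, 0 ≤ x → ‖b x‖ ≤ x / 2 := fun x hx =>
        (hf _ _).trans_eq (by
          rw [show t + x - (t + x / 2) = x / 2 by ring, abs_of_nonneg (by linarith)])
      have lowa : ∀ x, 0 ≤ x → x ≤ h → x / 2 * (3 / 4 - (x / 2 / δ) ^ α / 4) ≤ ‖a x‖ :=
        fun x hx hxh => ih _ (by linarith) (by rw [pow_succ] at hh; linarith) (by linarith) t
      have lowb : ∀ x, 0 ≤ x → x ≤ h → x / 2 * (3 / 4 - (x / 2 / δ) ^ α / 4) ≤ ‖b x‖ :=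
        fun x hx hxh => by
          have := ih (x / 2) (by linarith) (by rw [pow_succ] at hh; linarith) (by linarith)
            (t + x / 2)
          rwa [add_assoc, add_halves] at this
      have low : ∀ x, 0 ≤ x → x ≤ h → x / 4 ≤ x / 2 * (3 / 4 - (x / 2 / δ) ^ α / 4) :=
        fun x hx hxh => by
          have := le_one (x / 2) (by linarith) (by linarith)
          nlinarith
      have hW : ∀ x, 0 < x → x ≤ h → wedgeNorm (a x) (b x) ≤ K * x ^ α * x ^ 2 := by
        intro x hx hxh
        have e : f t - f (t + x / 2) = -a x := by simp [ha]
        have e2 : f t - f (t + x) = -(a x + b x) := by rw [hab]; simp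
        have := flat (t + x / 2) t (t + x) x hx (hxh.trans hhδ)
          (by rw [e, norm_neg]; linarith [upa x hx.le]) (by linarith [upb x hx.le])
          (by rw [e2, norm_neg]; linarith [norm_add_le (a x) (b x), upa x hx.le, upb x hx.le])
        rwa [e, wedgeNorm_neg_left] at this
      have hKx : ∀ x, 0 < x → x ≤ h → K * x ^ α < 1 / 16 := by
        intro x hx hxh
        have : K * x ^ α ≤ K * δ ^ α := by gcongr; linarith
        linarith
      -- Orthogonal half-chords of length at least `x/4` would have wedge norm at least `x²/16`,
      -- against flatness.
      have ne : ∀ x, 0 < x → x ≤ h → inner ℝ (a x) (b x) ≠ 0 := by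
        intro x hx hxh h0
        have h1 := mul_sub_wedgeNorm_le_abs_inner (a x) (b x)
        rw [h0, abs_zero] at h1
        have h2 : x / 4 * (x / 4) ≤ ‖a x‖ * ‖b x‖ :=
          mul_le_mul ((low x hx.le hxh).trans (lowa x hx.le hxh))
            ((low x hx.le hxh).trans (lowb x hx.le hxh)) (by positivity) (norm_nonneg _)
        have h3 := hW x hx hxh
        have h4 := hKx x hx hxh
        have h5 : 0 < x ^ 2 := by positivity
        nlinarith
      -- Works since `(3/4)² > 1/2`: halves of length at most `x/2` must point the same way.
      have small : ∀ x, 0 < x → x ≤ ρ → 0 < inner ℝ (a x) (b x) := by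
        intro x hx hxρ
        have h1 := hfρ t x hx.le hxρ
        rw [← hab] at h1
        have h2 := norm_add_sq_real (a x) (b x)
        have h3 := upa x hx.le
        have h4 := upb x hx.le
        have h5 : (3 / 4 * x) ^ 2 ≤ ‖a x + b x‖ ^ 2 := by gcongr
        have h6 : ‖a x‖ ^ 2 ≤ (x / 2) ^ 2 := by gcongr
        have h7 : ‖b x‖ ^ 2 ≤ (x / 2) ^ 2 := by gcongr
        nlinarith [mul_pos hx hx]
      have hin : 0 < inner ℝ (a h) (b h) := by
        by_contra! hneg
        have hmin : 0 < min ρ h := lt_min hρ hpos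
        have hc : ContinuousOn (fun x => inner ℝ (a x) (b x)) (Set.Icc (min ρ h) h) := by
          simp only [ha, hb]
          fun_prop
        obtain ⟨x, hx, hx0⟩ := intermediate_value_Icc' (min_le_right ρ h) hc
          ⟨hneg, (small _ hmin (min_le_left _ _)).le⟩
        exact ne x (hmin.trans_le hx.1) hx.2 hx0
      have hla := lowa h h0 le_rfl
      have hlb := lowb h h0 le_rfl
      have hl := low h h0 le_rfl
      have hadd := norm_add_norm_sub_le_norm_add hin.le (s := h / 2) (by positivity) (by linarith)
      rw [hab] at hadd
      have hWh : 2 * wedgeNorm (a h) (b h) / (h / 2) ≤ 4 * (K * h ^ α) * h := by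
        rw [div_le_iff₀ (by positivity)]
        linarith [hW h hpos le_rfl]
      have e1 : (h / 2 / δ) ^ α = (1 / 2) ^ α * (h / δ) ^ α := by
        rw [← Real.mul_rpow (by positivity) (by positivity)]
        congr 1
        ring
      have e2 : K * h ^ α ≤ (1 - (1 / 2) ^ α) / 16 * (h / δ) ^ α := by
        have : h ^ α = δ ^ α * (h / δ) ^ α := by
          rw [← Real.mul_rpow (by positivity) (by positivity), mul_div_cancel₀ _ hδ.ne']
        rw [this, ← mul_assoc]
        gcongr
      rw [e1] at hla hlb
      nlinarith
  obtain ⟨k, hk⟩ := pow_unbounded_of_one_lt (h / ρ) one_lt_two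
  have h1 := main k h h0 (by rw [div_lt_iff₀ hρ] at hk; exact hk.le) hhδ t
  have h2 := le_one h h0 hhδ
  nlinarith

end Local

namespace IsInjectiveArclengthC1

variable {n : ℕ} {γ : UnitAddCircle → EuclideanSpace ℝ (Fin n)}

lemma exists_three_quarters_mul_le_norm_sub (hγ : IsInjectiveArclengthC1 γ) :
    ∃ ρ : ℝ, 0 < ρ ∧ ∀ t h : ℝ, 0 ≤ h → h ≤ ρ →
      3 / 4 * h ≤ ‖γ ((t + h : ℝ) : UnitAddCircle) - γ (t : UnitAddCircle)‖ := by
  set f : ℝ → EuclideanSpace ℝ (Fin n) := fun t => γ (t : UnitAddCircle) with hf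
  have hfd : Differentiable ℝ f := hγ.contDiff.differentiable one_ne_zero
  have hf' : Continuous (deriv f) := hγ.contDiff.continuous_deriv le_rfl
  have huc := (isCompact_Icc (a := (0 : ℝ)) (b := 2)).uniformContinuousOn_of_continuous
    hf'.continuousOn
  -- By periodicity the chord may start in `[0, 1)`; with `h ≤ 1` it stays in `[0, 2]`.
  obtain ⟨ε, hε, hfε⟩ := Metric.uniformContinuousOn_iff.1 huc (1 / 4) (by norm_num)
  refine ⟨min (ε / 2) 1, by positivity, fun t h h0 hh => ?_⟩
  have key : ∀ s ∈ Set.Ico (0 : ℝ) 1, 3 / 4 * h ≤ ‖f (s + h) - f s‖ := by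
    intro s hs
    have hh1 := hh.trans (min_le_left _ _)
    have hh2 := hh.trans (min_le_right _ _)
    have hd : ∀ x, HasDerivAt (fun x => f x - x • deriv f s) (deriv f x - deriv f s) x := fun x => by
      have h1 := (hfd x).hasDerivAt.sub ((hasDerivAt_id x).smul_const (deriv f s))
      rw [one_smul] at h1
      exact h1
    have := (convex_Icc s (s + h)).norm_image_sub_le_of_norm_hasDerivWithin_le (C := 1 / 4)
      (f := fun x => f x - x • deriv f s)
      (fun x _ => (hd x).hasDerivWithinAt) (fun x hx => by
        rw [← dist_eq_norm]
        refine (hfε x ⟨by linarith [hx.1, hs.1], by linarith [hx.2, hs.2]⟩ s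
          ⟨hs.1, by linarith [hs.2]⟩ ?_).le
        rw [Real.dist_eq, abs_of_nonneg (by linarith [hx.1])]
        linarith [hx.2])
      (Set.left_mem_Icc.2 (by linarith)) (Set.right_mem_Icc.2 (by linarith))
    have e : f (s + h) - (s + h) • deriv f s - (f s - s • deriv f s)
        = (f (s + h) - f s) - h • deriv f s := by
      rw [add_smul]; abel
    rw [e, add_sub_cancel_left, Real.norm_eq_abs, abs_of_nonneg h0, norm_sub_rev] at this
    have h3 := norm_sub_norm_le (h • deriv f s) (f (s + h) - f s)
    rw [norm_smul, hγ.norm_deriv, Real.norm_eq_abs, abs_of_nonneg h0] at h3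
    linarith
  have hper : ∀ x : ℝ, f (Int.fract t + x) = f (t + x) := fun x => by
    have : t + x = Int.fract t + x + ⌊t⌋ := by linarith [Int.fract_add_floor t]
    have h0 : ((⌊t⌋ : ℝ) : UnitAddCircle) = 0 := by
      rw [AddCircle.coe_eq_zero_iff]
      exact ⟨⌊t⌋, by simp⟩
    rw [this]
    simp only [hf]
    rw [AddCircle.coe_add _ (Int.fract t + x), h0, add_zero]
  have := key (Int.fract t) ⟨Int.fract_nonneg t, Int.fract_lt_one t⟩
  rw [hper] at this
  have h2 := hper 0
  rw [add_zero, add_zero] at h2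
  rwa [h2] at this

end IsInjectiveArclengthC1

lemma exists_pos_mul_rpow_le {K α c : ℝ} (hK : 0 < K) (hα : 0 < α) (hc : 0 < c) :
    ∃ δ : ℝ, 0 < δ ∧ δ ≤ 1 / 2 ∧ K * δ ^ α ≤ c := by
  refine ⟨min (1 / 2) ((c / K) ^ (1 / α)), by positivity, min_le_left _ _, ?_⟩
  calc K * min (1 / 2) ((c / K) ^ (1 / α)) ^ α ≤ K * ((c / K) ^ (1 / α)) ^ α := by
        gcongr
        exact min_le_right _ _
    _ = c := by
        rw [← Real.rpow_mul (by positivity), one_div_mul_cancel hα.ne', Real.rpow_one]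
        field_simp

/-- Three vectors of comparable length whose endpoints keep their distance cannot be pairwise almost
parallel: they would be pairwise almost antiparallel. -/
lemma false_of_small_wedgeNorm {n : ℕ} {a b c : EuclideanSpace ℝ (Fin n)} {ε : ℝ} (hε : 0 < ε)
    (ha : ‖a‖ = ε) (hb1 : ε / 2 ≤ ‖b‖) (hb2 : ‖b‖ ≤ ε) (hc1 : ε / 2 ≤ ‖c‖) (hc2 : ‖c‖ ≤ ε)
    (hab : ε ≤ ‖a - b‖) (hac : ε ≤ ‖a - c‖) (hbc : ε ≤ ‖b - c‖)
    (hWab : wedgeNorm a b ≤ ε ^ 2 / 16) (hWac : wedgeNorm a c ≤ ε ^ 2 / 16)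
    (hWbc : wedgeNorm b c ≤ ε ^ 2 / 16) : False := by
  have anti : ∀ x y : EuclideanSpace ℝ (Fin n), ε / 2 ≤ ‖x‖ → ‖x‖ ≤ ε → ε / 2 ≤ ‖y‖ → ‖y‖ ≤ ε →
      ε ≤ ‖x - y‖ → wedgeNorm x y ≤ ε ^ 2 / 16 → inner ℝ x y ≤ ε ^ 2 / 16 - ‖x‖ * ‖y‖ := by
    intro x y hx1 hx2 hy1 hy2 hxy hW
    have h1 := mul_sub_wedgeNorm_le_abs_inner x y
    rcases abs_cases (inner ℝ x y) with ⟨h, -⟩ | ⟨h, -⟩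
    -- Almost parallel vectors would give `‖x - y‖² ≤ (ε/2)² + ε²/8 < ε²`.
    · exfalso
      have h2 := norm_sub_sq_real x y
      have h3 : ε ^ 2 ≤ ‖x - y‖ ^ 2 := by gcongr
      have h4 : (‖x‖ - ‖y‖) ^ 2 ≤ (ε / 2) ^ 2 := sq_le_sq' (by linarith) (by linarith)
      nlinarith [mul_pos hε hε]
    · linarith
  have h1 := anti a b (by linarith) ha.le hb1 hb2 hab hWab
  have h2 := anti a c (by linarith) ha.le hc1 hc2 hac hWac
  have h3 := anti b c hb1 hb2 hc1 hc2 hbc hWbc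
  have h4 : ‖a + b + c‖ ^ 2 = ‖a‖ ^ 2 + ‖b‖ ^ 2 + ‖c‖ ^ 2 +
      2 * (inner ℝ a b + inner ℝ a c + inner ℝ b c) := by
    rw [norm_add_sq_real, norm_add_sq_real, inner_add_left]
    ring
  have h5 := sq_nonneg ‖a + b + c‖
  rw [ha] at h1 h2 h4
  have h6 : (‖b‖ + ‖c‖ - ε) ^ 2 ≤ ε ^ 2 := sq_le_sq' (by linarith) (by linarith)
  have h7 : ε / 2 * (ε / 2) ≤ ‖b‖ * ‖c‖ := by gcongr
  have h8 : 0 ≤ (ε - ‖b‖) * (‖c‖ - ε / 2) := mul_nonneg (by linarith) (by linarith)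
  have h9 : 0 ≤ (ε - ‖c‖) * (‖b‖ - ε / 2) := mul_nonneg (by linarith) (by linarith)
  nlinarith [mul_pos hε hε]

/-! ### From flatness to local and global chord-arc bounds -/

namespace IsInjectiveArclengthC1

variable {n : ℕ} {γ : UnitAddCircle → EuclideanSpace ℝ (Fin n)}

lemma norm_sub_le_two_mul_of_flat (hγ : IsInjectiveArclengthC1 γ) {K α δ : ℝ} (hα : 0 < α)
    (hK : 0 ≤ K) (hδ : 0 < δ) (hKδ : K * δ ^ α ≤ (1 - (1 / 2) ^ α) / 16)
    (flat : ∀ (u v w : UnitAddCircle) (d : ℝ), 0 < d → d ≤ δ →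
      ‖γ v - γ u‖ ≤ d → ‖γ w - γ u‖ ≤ d → ‖γ v - γ w‖ ≤ d →
        wedgeNorm (γ v - γ u) (γ w - γ u) ≤ K * d ^ α * d ^ 2)
    (u v : UnitAddCircle) (huv : ‖u - v‖ ≤ δ) : ‖u - v‖ ≤ 2 * ‖γ u - γ v‖ := by
  obtain ⟨ρ, hρ, hγρ⟩ := hγ.exists_three_quarters_mul_le_norm_sub
  have key : ∀ t h : ℝ, 0 ≤ h → h ≤ δ →
      h ≤ 2 * ‖γ ((t + h : ℝ) : UnitAddCircle) - γ (t : UnitAddCircle)‖ := fun t h h0 hh => by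
    have := half_mul_le_norm_sub_of_flat (f := fun t : ℝ => γ (t : UnitAddCircle))
      hγ.norm_sub_le_abs hρ hγρ hα hK hδ hKδ (fun s t w d => flat s t w d) t h h0 hh
    linarith
  obtain ⟨s, hs, hs'⟩ := UnitAddCircle.exists_coe_eq_norm_eq (u - v)
  rw [← hs'] at huv ⊢
  obtain ⟨t, rfl⟩ : ∃ t : ℝ, (t : UnitAddCircle) = v := QuotientAddGroup.mk_surjective v
  have hu : u = ((t + s : ℝ) : UnitAddCircle) := by
    rw [AddCircle.coe_add, hs, add_sub_cancel]
  rw [hu]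
  rcases le_total 0 s with h | h
  · rw [abs_of_nonneg h] at huv ⊢
    exact key t s h huv
  · rw [abs_of_nonpos h] at huv ⊢
    have := key (t + s) (-s) (by linarith) huv
    rwa [add_neg_cancel_right, norm_sub_rev] at this

/-- Flatness of all small inscribed triangles, together with a bi-Lipschitz bound at scale `δ`,
keeps points that are far apart on the circle from being close in space. -/
lemma div_four_le_norm_sub_of_flat (hγ : IsInjectiveArclengthC1 γ) {δ : ℝ} (hδ : 0 < δ)
    (hδ1 : δ ≤ 1 / 2) (loc : ∀ u v : UnitAddCircle, ‖u - v‖ ≤ δ → ‖u - v‖ ≤ 2 * ‖γ u - γ v‖)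
    (flat : ∀ (u v w : UnitAddCircle) (d : ℝ), 0 < d → d ≤ δ →
      ‖γ v - γ u‖ ≤ d → ‖γ w - γ u‖ ≤ d → ‖γ v - γ w‖ ≤ d →
        wedgeNorm (γ v - γ u) (γ w - γ u) ≤ d ^ 2 / 64)
    (u v : UnitAddCircle) (huv : δ ≤ ‖u - v‖) : δ / 4 ≤ ‖γ u - γ v‖ := by
  have hcont := hγ.continuous
  have hS : IsCompact {x : UnitAddCircle × UnitAddCircle | δ ≤ ‖x.1 - x.2‖} :=
    (isClosed_le continuous_const (by fun_prop)).isCompact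
  obtain ⟨⟨x, y⟩, hxy, hmin⟩ := hS.exists_isMinOn ⟨(u, v), huv⟩
    (f := fun x => ‖γ x.1 - γ x.2‖) (by fun_prop)
  refine le_trans ?_ (isMinOn_iff.1 hmin (u, v) huv)
  simp only [Set.mem_ofPred_eq] at hxy ⊢
  by_contra! hlt
  set ε := ‖γ x - γ y‖ with hε_def
  have hε : 0 < ε := by
    refine norm_pos_iff.2 (sub_ne_zero.2 fun h => ?_)
    rw [hγ.injective h, sub_self, norm_zero] at hxy
    linarith
  have hnorm : ∀ s : ℝ, |s| ≤ 1 / 2 → ‖(s : UnitAddCircle)‖ = |s| := fun s hs =>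
    (AddCircle.norm_coe_eq_abs_iff 1 one_ne_zero).2 (by simpa using hs)
  -- Either minimality applies to `(z, y)`, or `loc` does: `‖z - y‖ ≥ δ - ε > 3ε`.
  have far : ∀ z, ‖x - z‖ ≤ ε → ε ≤ ‖γ z - γ y‖ := by
    intro z hz
    rcases le_total δ ‖z - y‖ with h | h
    · exact isMinOn_iff.1 hmin (z, y) h
    · have h1 := loc z y h
      have h2 := norm_sub_le_norm_sub_add_norm_sub x z y
      linarith
  set e : UnitAddCircle := ((ε : ℝ) : UnitAddCircle) with he
  have hne : ‖e‖ = ε := by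
    rw [hnorm _ (by rw [abs_of_pos hε]; linarith), abs_of_pos hε]
  have hne2 : ‖e + e‖ = 2 * ε := by
    rw [he, ← AddCircle.coe_add, hnorm _ (by rw [abs_of_pos (by positivity)]; linarith),
      abs_of_pos (by positivity)]
    ring
  have step : ∀ z, ‖z - x‖ = ε → ε / 2 ≤ ‖γ z - γ x‖ ∧ ‖γ z - γ x‖ ≤ ε := fun z hz =>
    ⟨by linarith [loc z x (by linarith)], (hγ.norm_sub_le z x).trans_eq hz⟩
  have hz1 : ‖x + e - x‖ = ε := by rw [add_sub_cancel_left, hne]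
  have hz2 : ‖x - e - x‖ = ε := by rw [sub_sub_cancel_left, norm_neg, hne]
  have h12 : ‖x + e - (x - e)‖ = 2 * ε := by
    rw [← hne2]
    congr 1
    abel
  obtain ⟨hb1, hb2⟩ := step _ hz1
  obtain ⟨hc1, hc2⟩ := step _ hz2
  have ha : ‖γ y - γ x‖ = ε := norm_sub_rev _ _
  have hW : ∀ z w : UnitAddCircle, ‖γ z - γ x‖ ≤ ε → ‖γ w - γ x‖ ≤ ε →
      wedgeNorm (γ z - γ x) (γ w - γ x) ≤ ε ^ 2 / 16 := fun z w hz hw => by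
    have h1 := norm_sub_le_norm_sub_add_norm_sub (γ z) (γ x) (γ w)
    rw [norm_sub_rev (γ x)] at h1
    have := flat x z w (2 * ε) (by positivity) (by linarith) (by linarith) (by linarith)
      (by linarith)
    linarith
  refine false_of_small_wedgeNorm hε ha hb1 hb2 hc1 hc2 ?_ ?_ ?_ (hW _ _ ha.le hb2)
    (hW _ _ ha.le hc2) (hW _ _ hb2 hc2)
  · rw [sub_sub_sub_cancel_right, norm_sub_rev]
    exact far _ (by rw [norm_sub_rev, hz1])
  · rw [sub_sub_sub_cancel_right, norm_sub_rev]
    exact far _ (by rw [norm_sub_rev, hz2])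
  · rw [sub_sub_sub_cancel_right]
    have := loc _ _ (h12.trans_le (by linarith))
    linarith

end IsInjectiveArclengthC1

theorem mainTheorem3 (p q : ℝ) (hq : 1 < q) (hp : p ∈ Set.Ioo (2 / 3 * q + 1) (q + 2 / 3))
    (M : ℝ≥0∞) (hM : M < ∞) :
    ∃ C : ℝ, 0 < C ∧
      ∀ (n : ℕ) (γ : UnitAddCircle → EuclideanSpace ℝ (Fin n)),
        IsInjectiveArclengthC1 γ → mengerEnergy p q γ ≤ M →
          ∀ u v : UnitAddCircle, ‖u - v‖ ≤ C * ‖γ u - γ v‖ := by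
  obtain ⟨K, hK, hflat⟩ :=
    exists_wedgeNorm_le_of_mengerEnergy_le (p := p) (q := q) (by linarith [hp.1]) (by linarith) hM
  set α := (3 * p - 2 * q - 3) / (q + 3) with hα_def
  have hα : 0 < α := div_pos (by linarith [hp.1]) (by linarith)
  have h2 : ((1 : ℝ) / 2) ^ α < 1 := Real.rpow_lt_one (by norm_num) (by norm_num) hα
  have h2' : 0 < ((1 : ℝ) / 2) ^ α := by positivity
  -- The `64` gives `K δ^α ≤ 1/64` for the global step; the local step needs only `16`.
  obtain ⟨δ, hδ, hδ1, hKδ⟩ :=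
    exists_pos_mul_rpow_le hK hα (c := (1 - (1 / 2) ^ α) / 64) (by linarith)
  -- Far pairs: `‖u - v‖ ≤ 1/2 = (2/δ)(δ/4)`. Near pairs need only the constant `2`.
  refine ⟨2 / δ, by positivity, fun n γ hγ hE u v => ?_⟩
  have flat : ∀ (u v w : UnitAddCircle) (d : ℝ), 0 < d → d ≤ δ →
      ‖γ v - γ u‖ ≤ d → ‖γ w - γ u‖ ≤ d → ‖γ v - γ w‖ ≤ d →
        wedgeNorm (γ v - γ u) (γ w - γ u) ≤ K * d ^ α * d ^ 2 :=
    fun u v w d hd hdδ => hflat n γ hγ hE u v w d hd (by linarith)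
  have loc := hγ.norm_sub_le_two_mul_of_flat hα hK.le hδ (by linarith) flat
  rw [div_mul_eq_mul_div, le_div_iff₀ hδ]
  have hhalf : ‖u - v‖ ≤ 1 / 2 := by
    simpa using AddCircle.norm_le_half_period 1 (x := u - v) one_ne_zero
  rcases le_total ‖u - v‖ δ with h | h
  · nlinarith [loc u v h, norm_nonneg (u - v)]
  · have := hγ.div_four_le_norm_sub_of_flat hδ hδ1 loc (fun u v w d hd hdδ h1 h2 h3 => by
      refine (flat u v w d hd hdδ h1 h2 h3).trans ?_
      have : K * d ^ α ≤ K * δ ^ α := by gcongr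
      nlinarith [sq_nonneg d]) u v h
    nlinarith
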